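/- All digraphs are finite and simple (no loops, no multiple arcs). The complementarity spectrum $\Pi(D)$ of a digraph $D$ on $n$ vertices with $0$-$1$ adjacency matrix $A$ is the set of all $\lambda\in\mathbb{R}$ for which there is a nonzero vector $x\in\mathbb{R}^n$ with $x\ge 0$, $Ax\ge\lambda x$ (coordinatewise) and $\langle x, Ax-\lambda x\rangle=0$. For integers $r,s\ge 2$ let $\infty(r,s)$ be the digraph obtained from disjoint directed cycles of lengths $r$ and $s$ by identifying one vertex of the first with one vertex of the second. For integers $a,b,c\ge 0$ with $a,b$ not both $0$ let $\theta(a,b,c)$ be the digraph formed by three directed paths with $a+2$, $b+2$ and $c+2$ vertices that share only their end vertices, the first two going from a vertex $u$ to a vertex $v\neq u$ and the third from $v$ to $u$. **Proposition.** (a) For all integers $a,c\ge 0$ and $b>0$ there exist integers $2\le r\le s$ such that $\Pi(\theta(a,b,c))=\Pi(\infty(r,s))$. (b) For all integers $2\le r<s$ there exist $r-1$ pairwise non-isomorphic digraphs $\theta(a,b,c)$, with $0\le a\le b$, $b>0$ and $c\ge 0$, such that $\Pi(\theta(a,b,c))=\Pi(\infty(r,s))$. For $r=s\ge 2$ there exist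 $r-2$ pairwise non-isomorphic such digraphs $\theta(a,b,c)$ with $\Pi(\theta(a,b,c))=\Pi(\infty(r,r))$. -/

import Mathlib

namespace CompSpec

/-- The complementarity spectrum of a real square matrix `A`: the set of all real `μ` for which
there is a nonzero vector `x ≥ 0` with `A x ≥ μ x` and `⟨x, A x - μ x⟩ = 0`. -/
def matrixSpectrum {V : Type*} [Fintype V] (A : Matrix V V ℝ) : Set ℝ :=
  {μ : ℝ | ∃ x : V → ℝ, x ≠ 0 ∧ (∀ i, 0 ≤ x i) ∧ (∀ i, μ * x i ≤ (Matrix.mulVec A x) i) ∧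
    dotProduct x (Matrix.mulVec A x - μ • x) = 0}

open Classical in
/-- The `0`-`1` adjacency matrix of a digraph, with entry `1` at `(i, j)` exactly when
there is an arc from `i` to `j`. -/
noncomputable def adjMatrix {V : Type*} (D : Digraph V) : Matrix V V ℝ :=
  Matrix.of fun i j => if D.Adj i j then 1 else 0

/-- The complementarity spectrum of a finite digraph. -/
def spectrum {V : Type*} [Fintype V] (D : Digraph V) : Set ℝ :=
  matrixSpectrum (adjMatrix D)

/-- Two digraphs are isomorphic if some bijection of the vertices preserves and reflects arcs. -/
def Isomorphic {V W : Type*} (D : Digraph V) (E : Digraph W) : Prop :=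
  Nonempty (D.Adj ≃r E.Adj)

/-- The directed cycle with `n` vertices `0 → 1 → ⋯ → n - 1 → 0`. -/
def dicycle (n : ℕ) : Digraph (Fin n) where
  Adj i j := (j : ℕ) = ((i : ℕ) + 1) % n

/-- The directed path with `n` vertices `0 → 1 → ⋯ → n - 1`. -/
def dipath (n : ℕ) : Digraph (Fin n) where
  Adj i j := (j : ℕ) = (i : ℕ) + 1

/-- The vertices of the coalescence of two cycles of lengths `r, s ≥ 1`: the common vertex
`none`, the other `r - 1` vertices of the first cycle, the other `s - 1` of the second. -/
abbrev InftyVertex (r s : ℕ) : Type := Option (Fin (r - 1) ⊕ Fin (s - 1))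

/-- The first cycle of `∞(r, s)`, as a map from the vertices of a cycle of length `r - 1 + 1`
(which is `r` as soon as `r ≥ 1`); the vertex `0` goes to the common vertex. -/
def inftyLeft (r s : ℕ) : Fin (r - 1 + 1) → InftyVertex r s :=
  Fin.cons none fun i => some (Sum.inl i)

/-- The second cycle of `∞(r, s)`; again `0` goes to the common vertex. -/
def inftyRight (r s : ℕ) : Fin (s - 1 + 1) → InftyVertex r s :=
  Fin.cons none fun j => some (Sum.inr j)

/-- The digraph `∞(r, s)`: the coalescence of directed cycles of lengths `r` and `s`, that is,
their disjoint union with one vertex of the first identified with one vertex of the second. -/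
def infty (r s : ℕ) : Digraph (InftyVertex r s) where
  Adj p q :=
    Relation.Map (dicycle (r - 1 + 1)).Adj (inftyLeft r s) (inftyLeft r s) p q ∨
    Relation.Map (dicycle (s - 1 + 1)).Adj (inftyRight r s) (inftyRight r s) p q

/-- The vertices of `θ(a, b, c)`: the two branch vertices, and the `a`, `b` and `c` inner
vertices of the three paths. -/
abbrev ThetaVertex (a b c : ℕ) : Type := Fin 2 ⊕ (Fin a ⊕ (Fin b ⊕ Fin c))

/-- The sequence `u, f 0, …, f (n - 1), v`. -/
def between {V : Type*} {n : ℕ} (u v : V) (f : Fin n → V) : Fin (n + 2) → V :=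
  Fin.cons u (Fin.snoc f v : Fin (n + 1) → V)

/-- The first path of `θ(a, b, c)`, from the branch vertex `0` to the branch vertex `1`. -/
def thetaPathA (a b c : ℕ) : Fin (a + 2) → ThetaVertex a b c :=
  between (Sum.inl 0) (Sum.inl 1) fun i => Sum.inr (Sum.inl i)

/-- The second path of `θ(a, b, c)`, from the branch vertex `0` to the branch vertex `1`. -/
def thetaPathB (a b c : ℕ) : Fin (b + 2) → ThetaVertex a b c :=
  between (Sum.inl 0) (Sum.inl 1) fun i => Sum.inr (Sum.inr (Sum.inl i))

/-- The third path of `θ(a, b, c)`, from the branch vertex `1` back to the branch vertex `0`. -/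
def thetaPathC (a b c : ℕ) : Fin (c + 2) → ThetaVertex a b c :=
  between (Sum.inl 1) (Sum.inl 0) fun i => Sum.inr (Sum.inr (Sum.inr i))

/-- The digraph `θ(a, b, c)`: three directed paths with `a + 2`, `b + 2` and `c + 2` vertices,
sharing only their end vertices, the first two from the branch vertex `0` to the branch vertex
`1`, the third from `1` to `0`. It is used for `a, b` not both zero (for `a = b = 0` the
definition with paths would call for a double arc). -/
def theta (a b c : ℕ) : Digraph (ThetaVertex a b c) where
  Adj p q :=
    Relation.Map (dipath (a + 2)).Adj (thetaPathA a b c) (thetaPathA a b c) p q ∨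
    Relation.Map (dipath (b + 2)).Adj (thetaPathB a b c) (thetaPathB a b c) p q ∨
    Relation.Map (dipath (c + 2)).Adj (thetaPathC a b c) (thetaPathC a b c) p q

end CompSpec

namespace CompSpec

open Matrix

/-! ### Complementarity eigenvectors of a digraph -/

section General

/-! Both families consist of two cycles through a common branch vertex, and the spectrum sees only
the cycle lengths `r`, `s` (for `θ(a, b, c)`: `a + c + 2`, `b + c + 2`). For `μ > 0`, each arc
leaving a non-branching support vertex multiplies the entry by `μ`, so the support runs on to the
branch vertex. Its equation gives `μ = 1` if one returning path is used and `μ ^ (-r) + μ ^ (-s) =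
1` if both are; conversely, geometric weights realise these values. Hence `spectrum_infty` and
`spectrum_theta` both yield `twoCycleSet`. Fixing `r`, `s` leaves `c` free, and the `r + s - 2 - c`
vertices separate the digraphs. -/

lemma adjMatrix_nonneg {V : Type*} (D : Digraph V) (i j : V) : 0 ≤ adjMatrix D i j := by
  unfold adjMatrix
  simp only [Matrix.of_apply]
  split_ifs <;> norm_num

variable {V : Type*} [Fintype V]

lemma mulVec_adjMatrix_nonneg (D : Digraph V) {x : V → ℝ} (hx : ∀ i, 0 ≤ x i) (i : V) :
    0 ≤ (adjMatrix D *ᵥ x) i :=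
  Finset.sum_nonneg fun j _ => mul_nonneg (adjMatrix_nonneg D i j) (hx j)

/-- Complementarity eigenvectors are the nonnegative vectors that satisfy the eigenvalue
equation on their support. -/
lemma mem_spectrum_iff (D : Digraph V) (μ : ℝ) :
    μ ∈ spectrum D ↔ ∃ x : V → ℝ, x ≠ 0 ∧ (∀ i, 0 ≤ x i) ∧
      ∀ i, 0 < x i → (adjMatrix D *ᵥ x) i = μ * x i := by
  constructor
  · rintro ⟨x, hx0, hx, hle, hdot⟩
    refine ⟨x, hx0, hx, fun i hi => ?_⟩
    have h := (Finset.sum_eq_zero_iff_of_nonneg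
      (fun j _ => mul_nonneg (hx j) (sub_nonneg.2 (hle j)))).1 hdot i (Finset.mem_univ i)
    rcases mul_eq_zero.1 h with h | h
    · exact absurd h hi.ne'
    · exact sub_eq_zero.1 h
  · rintro ⟨x, hx0, hx, h⟩
    refine ⟨x, hx0, hx, fun i => ?_, Finset.sum_eq_zero fun i _ => ?_⟩
    -- Off the support the inequality is free, since `A x ≥ 0`.
    · rcases (hx i).eq_or_lt with hi | hi
      · rw [← hi, mul_zero]
        exact mulVec_adjMatrix_nonneg D hx i
      · exact (h i hi).ge
    · rcases (hx i).eq_or_lt with hi | hi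
      · rw [← hi, zero_mul]
      · simp [h i hi]

lemma mulVec_of_adj_iff (D : Digraph V) (x : V → ℝ) {p t : V} (h : ∀ q, D.Adj p q ↔ q = t) :
    (adjMatrix D *ᵥ x) p = x t := by
  classical
  simp [Matrix.mulVec, dotProduct, adjMatrix, h]

lemma mulVec_of_adj_iff_or (D : Digraph V) (x : V → ℝ) {p t t' : V} (hne : t ≠ t')
    (h : ∀ q, D.Adj p q ↔ q = t ∨ q = t') : (adjMatrix D *ᵥ x) p = x t + x t' := by
  classical
  have key : ∀ q, adjMatrix D p q * x q = (if q = t then x q else 0) + if q = t' then x q else 0 := by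
    intro q
    simp only [adjMatrix, Matrix.of_apply, h]
    by_cases h1 : q = t
    · subst h1; simp [hne]
    · simp [h1]
  simp [Matrix.mulVec, dotProduct, key, Finset.sum_add_distrib]

/-- The indicator of a single loopless vertex is an eigenvector for `0`. -/
lemma zero_mem_spectrum (D : Digraph V) {p : V} (hp : ¬ D.Adj p p) : 0 ∈ spectrum D := by
  classical
  refine (mem_spectrum_iff D 0).2 ⟨Pi.single p 1, by simp, fun i => ?_, fun i hi => ?_⟩
  · by_cases h : i = p
    · subst h; simp
    · simp [h]
  · by_cases h : i = p
    · subst h; simp [adjMatrix, hp]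
    · simp [h] at hi

lemma nonneg_of_mem_spectrum {D : Digraph V} {μ : ℝ} (h : μ ∈ spectrum D) : 0 ≤ μ := by
  obtain ⟨x, hx0, hx, h⟩ := (mem_spectrum_iff D μ).1 h
  obtain ⟨i, hi⟩ := Function.ne_iff.1 hx0
  have hi : 0 < x i := (hx i).lt_of_ne' hi
  by_contra! hμ
  have := mulVec_adjMatrix_nonneg D hx i
  rw [h i hi] at this
  nlinarith

end General

/-! ### Paths, cycles and geometric growth along them -/

section Paths

variable {V : Type*}

lemma map_dipath_between {n : ℕ} (u v : V) (f : Fin n → V) (p q : V) :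
    Relation.Map (dipath (n + 2)).Adj (between u v f) (between u v f) p q ↔
      (p = u ∧ q = (Fin.snoc f v : Fin (n + 1) → V) 0) ∨
        ∃ i : Fin n, p = f i ∧ q = (Fin.snoc f v : Fin (n + 1) → V) i.succ := by
  have h1 : Relation.Map (dipath (n + 2)).Adj (between u v f) (between u v f) p q ↔
      ∃ k : Fin (n + 1), between u v f k.castSucc = p ∧ between u v f k.succ = q := by
    constructor
    · rintro ⟨i, j, hij, hp, hq⟩
      simp only [dipath] at hij
      refine ⟨⟨i, by omega⟩, ?_, ?_⟩
      · rw [← hp]; rfl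
      · rw [← hq]; congr 1; ext; simp [hij]
    · rintro ⟨k, hp, hq⟩
      exact ⟨k.castSucc, k.succ, by simp [dipath], hp, hq⟩
  rw [h1, Fin.exists_fin_succ]
  simp only [between, Fin.castSucc_zero, Fin.cons_zero, Fin.cons_succ, ← Fin.succ_castSucc,
    Fin.snoc_castSucc, eq_comm]

/-- A cycle is a path from `w` back to `w`: same form as `map_dipath_between` with `u = v = w`, so
the path lemmas serve both families. -/
lemma map_dicycle_cons {n : ℕ} (w : V) (f : Fin n → V) (p q : V) :
    Relation.Map (dicycle (n + 1)).Adj (Fin.cons w f : Fin (n + 1) → V)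
        (Fin.cons w f : Fin (n + 1) → V) p q ↔
      (p = w ∧ q = (Fin.snoc f w : Fin (n + 1) → V) 0) ∨
        ∃ i : Fin n, p = f i ∧ q = (Fin.snoc f w : Fin (n + 1) → V) i.succ := by
  have h0 : ∀ k j : Fin (n + 1), (j : ℕ) = ((k : ℕ) + 1) % (n + 1) →
      (Fin.cons w f : Fin (n + 1) → V) j = (Fin.snoc f w : Fin (n + 1) → V) k := by
    intro k j hj
    induction k using Fin.lastCases with
    | last =>
      have : j = 0 := by ext; simpa using hj
      subst this; simp
    | cast i =>
      have : j = i.succ := by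
        ext
        rw [hj, Fin.val_castSucc, Nat.mod_eq_of_lt (by omega), Fin.val_succ]
      subst this; simp
  have h1 : Relation.Map (dicycle (n + 1)).Adj (Fin.cons w f : Fin (n + 1) → V)
        (Fin.cons w f : Fin (n + 1) → V) p q ↔
      ∃ k : Fin (n + 1), (Fin.cons w f : Fin (n + 1) → V) k = p ∧
        (Fin.snoc f w : Fin (n + 1) → V) k = q := by
    constructor
    · rintro ⟨i, j, hij, hp, hq⟩
      exact ⟨i, hp, (h0 i j hij).symm.trans hq⟩
    · rintro ⟨k, hp, hq⟩
      let j : Fin (n + 1) := ⟨((k : ℕ) + 1) % (n + 1), Nat.mod_lt _ (by omega)⟩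
      exact ⟨k, j, rfl, hp, (h0 k j rfl).trans hq⟩
  rw [h1, Fin.exists_fin_succ]
  simp only [Fin.cons_zero, Fin.cons_succ, eq_comm]

lemma snoc_zero_of_pos {n : ℕ} (f : Fin n → V) (v : V) (h : 0 < n) :
    (Fin.snoc f v : Fin (n + 1) → V) 0 = f ⟨0, h⟩ := by
  have : (0 : Fin (n + 1)) = (⟨0, h⟩ : Fin n).castSucc := by ext; simp
  rw [this, Fin.snoc_castSucc]

lemma snoc_ne {n : ℕ} {f : Fin n → V} {v t : V} (hf : ∀ i, f i ≠ t) (hv : v ≠ t)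
    (k : Fin (n + 1)) : (Fin.snoc f v : Fin (n + 1) → V) k ≠ t := by
  induction k using Fin.lastCases with
  | last => simpa using hv
  | cast i => simpa using hf i

lemma snoc_geometric {n : ℕ} (x : V → ℝ) (f : Fin n → V) (v : V) {C μ : ℝ}
    (hf : ∀ i, x (f i) = C * μ ^ (i : ℕ)) (hv : x v = C * μ ^ n) (k : Fin (n + 1)) :
    x ((Fin.snoc f v : Fin (n + 1) → V) k) = C * μ ^ (k : ℕ) := by
  induction k using Fin.lastCases with
  | last => simpa using hv
  | cast i => simpa using hf i

/-- Along a path whose inner vertices satisfy the eigenvalue equation on the support, the first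
entry after the start either vanishes or is determined by the entry at the end. -/
lemma path_first {n : ℕ} {x : V → ℝ} {f : Fin n → V} {v : V} {μ : ℝ} (hμ : 0 < μ)
    (hx : ∀ p, 0 ≤ x p)
    (h : ∀ i, 0 < x (f i) → x ((Fin.snoc f v : Fin (n + 1) → V) i.succ) = μ * x (f i)) :
    x ((Fin.snoc f v : Fin (n + 1) → V) 0) = 0 ∨
      x v = μ ^ n * x ((Fin.snoc f v : Fin (n + 1) → V) 0) := by
  rcases (hx ((Fin.snoc f v : Fin (n + 1) → V) 0)).eq_or_lt with h0 | h0
  · exact Or.inl h0.symm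
  · right
    have key : ∀ k : Fin (n + 1), x ((Fin.snoc f v : Fin (n + 1) → V) k) =
        μ ^ (k : ℕ) * x ((Fin.snoc f v : Fin (n + 1) → V) 0) := by
      intro k
      induction k using Fin.induction with
      | zero => simp
      | succ i ih =>
        rw [Fin.snoc_castSucc, Fin.val_castSucc] at ih
        rw [h i (by rw [ih]; positivity), ih, Fin.val_succ]
        ring
    simpa using key (Fin.last n)

/-- Positivity propagates forward along the arcs; this forces the branch vertex into the support. -/
lemma path_end_pos {n : ℕ} {x : V → ℝ} {f : Fin n → V} {v : V} {μ : ℝ} (hμ : 0 < μ)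
    (h : ∀ i, 0 < x (f i) → x ((Fin.snoc f v : Fin (n + 1) → V) i.succ) = μ * x (f i))
    (i : Fin n) (hi : 0 < x (f i)) : 0 < x v := by
  have key : ∀ k : Fin (n + 1), 0 < x ((Fin.snoc f v : Fin (n + 1) → V) k) → 0 < x v := by
    intro k
    induction k using Fin.reverseInduction with
    | last => simp
    | cast i ih =>
      rw [Fin.snoc_castSucc]
      intro hi
      exact ih (by rw [h i hi]; positivity)
  exact key i.castSucc (by simpa using hi)

end Paths

/-- The numbers `0` and `1`, and the positive solutions of `μ ^ (-r) + μ ^ (-s) = 1`. -/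
def twoCycleSet (r s : ℕ) : Set ℝ :=
  {μ | μ = 0 ∨ μ = 1 ∨ (0 < μ ∧ μ ^ r + μ ^ s = μ ^ (r + s))}

lemma twoCycleSet_comm (r s : ℕ) : twoCycleSet r s = twoCycleSet s r := by
  ext μ
  simp only [twoCycleSet, Set.mem_ofPred_eq, add_comm]

/-- A branch vertex of weight `w` with two returning paths of total lengths `r` and `s` whose
first entries are `y` and `z`. -/
lemma mem_twoCycleSet_of_return {r s : ℕ} (hr : r ≠ 0) (hs : s ≠ 0) {μ w y z : ℝ} (hμ : 0 < μ)
    (hw : 0 < w) (hsum : y + z = μ * w) (hy : y = 0 ∨ w * μ = μ ^ r * y)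
    (hz : z = 0 ∨ w * μ = μ ^ s * z) : μ ∈ twoCycleSet r s := by
  have hwμ : 0 < w * μ := by positivity
  -- With only one path present, going once around its cycle gives `μ ^ n = 1`.
  have one : ∀ n : ℕ, n ≠ 0 → ∀ t, t = μ * w → w * μ = μ ^ n * t → μ = 1 := by
    intro n hn t ht h
    have : μ ^ n = 1 := by
      subst ht
      have h2 : (μ ^ n - 1) * (w * μ) = 0 := by linear_combination -h
      rcases mul_eq_zero.1 h2 with h2 | h2
      · linarith
      · exact absurd h2 hwμ.ne'
    exact (pow_eq_one_iff_of_nonneg hμ.le hn).1 this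
  rcases hy with hy | hy
  · rcases hz with hz | hz
    · subst hy hz
      nlinarith
    · exact Or.inr (Or.inl (one s hs z (by linarith) hz))
  · rcases hz with hz | hz
    · exact Or.inr (Or.inl (one r hr y (by linarith) hy))
    · refine Or.inr (Or.inr ⟨hμ, ?_⟩)
      -- This is `y + z = μ * w` multiplied by `μ ^ (r + s)`, with `y` and `z` eliminated.
      have h2 : (μ ^ r + μ ^ s - μ ^ (r + s)) * (w * μ) = 0 := by
        rw [pow_add]
        linear_combination μ ^ r * hz + μ ^ s * hy + μ ^ r * μ ^ s * hsum
      rcases mul_eq_zero.1 h2 with h2 | h2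
      · linarith
      · exact absurd h2 hwμ.ne'

/-- Each element `μ > 0` arises from a choice of weights: either both paths are present, or
only the first one is. -/
lemma exists_weight_of_mem_twoCycleSet {r s : ℕ} {μ : ℝ} (h : μ ∈ twoCycleSet r s)
    (h0 : μ ≠ 0) : 0 < μ ∧ ∃ β : ℝ, 0 ≤ β ∧ (β = 0 ∨ β = 1) ∧
      (μ ^ r)⁻¹ + β * (μ ^ s)⁻¹ = 1 := by
  rcases h with h | h | ⟨hμ, h⟩
  · exact absurd h h0
  · subst h
    exact ⟨one_pos, 0, le_rfl, Or.inl rfl, by simp⟩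
  · refine ⟨hμ, 1, zero_le_one, Or.inr rfl, ?_⟩
    rw [pow_add] at h
    field_simp
    linarith

/-! ### The spectrum of `∞(r, s)` -/

section Infty

lemma infty_adj_iff (r s : ℕ) (p q : InftyVertex r s) : (infty r s).Adj p q ↔
    ((p = none ∧ q = (Fin.snoc (fun i => some (Sum.inl i)) none :
        Fin (r - 1 + 1) → InftyVertex r s) 0) ∨
      ∃ i : Fin (r - 1), p = some (Sum.inl i) ∧ q = (Fin.snoc (fun i => some (Sum.inl i)) none :
        Fin (r - 1 + 1) → InftyVertex r s) i.succ) ∨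
    ((p = none ∧ q = (Fin.snoc (fun i => some (Sum.inr i)) none :
        Fin (s - 1 + 1) → InftyVertex r s) 0) ∨
      ∃ i : Fin (s - 1), p = some (Sum.inr i) ∧ q = (Fin.snoc (fun i => some (Sum.inr i)) none :
        Fin (s - 1 + 1) → InftyVertex r s) i.succ) :=
  or_congr (map_dicycle_cons _ _ p q) (map_dicycle_cons _ _ p q)

variable {r s : ℕ} (x : InftyVertex r s → ℝ)

lemma infty_mulVec_inl (i : Fin (r - 1)) :
    (adjMatrix (infty r s) *ᵥ x) (some (Sum.inl i)) =
      x ((Fin.snoc (fun i => some (Sum.inl i)) none : Fin (r - 1 + 1) → InftyVertex r s) i.succ) :=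
  mulVec_of_adj_iff _ _ fun q => by simp [infty_adj_iff]

lemma infty_mulVec_inr (i : Fin (s - 1)) :
    (adjMatrix (infty r s) *ᵥ x) (some (Sum.inr i)) =
      x ((Fin.snoc (fun i => some (Sum.inr i)) none : Fin (s - 1 + 1) → InftyVertex r s) i.succ) :=
  mulVec_of_adj_iff _ _ fun q => by simp [infty_adj_iff]

lemma infty_mulVec_none (hs : 2 ≤ s) :
    (adjMatrix (infty r s) *ᵥ x) none =
      x ((Fin.snoc (fun i => some (Sum.inl i)) none : Fin (r - 1 + 1) → InftyVertex r s) 0) +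
      x ((Fin.snoc (fun i => some (Sum.inr i)) none : Fin (s - 1 + 1) → InftyVertex r s) 0) := by
  refine mulVec_of_adj_iff_or _ _ ?_ fun q => by simp [infty_adj_iff]
  rw [snoc_zero_of_pos (n := s - 1) _ _ (by omega)]
  exact snoc_ne (by simp) (by simp) _

theorem spectrum_infty (hr : 2 ≤ r) (hs : 2 ≤ s) :
    spectrum (infty r s) = twoCycleSet r s := by
  ext μ
  constructor
  · intro h
    rcases (nonneg_of_mem_spectrum h).eq_or_lt with h0 | hμ
    · exact Or.inl h0.symm
    obtain ⟨x, hx0, hx, h⟩ := (mem_spectrum_iff _ μ).1 h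
    have hl := fun i hi => (infty_mulVec_inl x i).symm.trans (h _ hi)
    have hr' := fun i hi => (infty_mulVec_inr x i).symm.trans (h _ hi)
    have hw : 0 < x none := by
      obtain ⟨p, hp⟩ := Function.ne_iff.1 hx0
      have hp : 0 < x p := (hx p).lt_of_ne' hp
      rcases p with _ | i | i
      · exact hp
      · exact path_end_pos hμ hl i hp
      · exact path_end_pos hμ hr' i hp
    have hsum := (infty_mulVec_none x hs).symm.trans (h _ hw)
    refine mem_twoCycleSet_of_return (by omega) (by omega) hμ hw hsum ?_ ?_
    · refine (path_first hμ hx hl).imp_right fun e => ?_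
      rw [e, ← pow_sub_one_mul (by omega : r ≠ 0) μ]
      ring
    · refine (path_first hμ hx hr').imp_right fun e => ?_
      rw [e, ← pow_sub_one_mul (by omega : s ≠ 0) μ]
      ring
  · intro h
    by_cases h0 : μ = 0
    · subst h0
      refine zero_mem_spectrum _ (p := none) ?_
      rw [infty_adj_iff, snoc_zero_of_pos (n := r - 1) _ _ (by omega),
        snoc_zero_of_pos (n := s - 1) _ _ (by omega)]
      simp
    obtain ⟨hμ, β, hβ, hβ01, hsum⟩ := exists_weight_of_mem_twoCycleSet h h0
    -- Weight `1` at the common vertex, divided by `μ` for each step back along a cycle; `β = 0`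
    -- removes the second cycle, as `μ = 1` requires.
    let x : InftyVertex r s → ℝ := fun p => p.elim 1 (Sum.elim
      (fun i => (μ ^ (r - 1))⁻¹ * μ ^ (i : ℕ)) fun i => β * (μ ^ (s - 1))⁻¹ * μ ^ (i : ℕ))
    have hl := snoc_geometric x (fun i => some (Sum.inl i)) none
      (C := (μ ^ (r - 1))⁻¹) (μ := μ) (fun i => rfl)
      (inv_mul_cancel₀ (pow_pos hμ _).ne').symm
    have hzero : x ((Fin.snoc (fun i => some (Sum.inr i)) none :
        Fin (s - 1 + 1) → InftyVertex r s) 0) = β * (μ ^ (s - 1))⁻¹ := by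
      rw [snoc_zero_of_pos (n := s - 1) _ _ (by omega)]
      simp [x]
    refine (mem_spectrum_iff _ μ).2 ⟨x, Function.ne_iff.2 ⟨none, one_ne_zero⟩, ?_, ?_⟩
    · rintro (_ | i | i)
      · exact zero_le_one
      · simp only [x, Option.elim, Sum.elim_inl]; positivity
      · simp only [x, Option.elim, Sum.elim_inr]; positivity
    · rintro (_ | i | i) hi
      · rw [infty_mulVec_none x hs, hl, hzero]
        rw [← pow_sub_one_mul (by omega : r ≠ 0) μ, ← pow_sub_one_mul (by omega : s ≠ 0) μ] at hsum
        have : x none = 1 := rfl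
        rw [this, ← hsum]
        simp only [Fin.val_zero, pow_zero]
        field_simp
      · rw [infty_mulVec_inl, hl]
        simp only [x, Option.elim, Sum.elim_inl, Fin.val_succ]
        ring
      · rcases hβ01 with rfl | rfl
        · simp [x] at hi
        · rw [infty_mulVec_inr, snoc_geometric x (fun i => some (Sum.inr i)) none
            (C := 1 * (μ ^ (s - 1))⁻¹) (μ := μ) (fun i => rfl)
            (by rw [one_mul]; exact (inv_mul_cancel₀ (pow_pos hμ _).ne').symm)]
          simp only [x, Option.elim, Sum.elim_inr, Fin.val_succ]
          ring

end Infty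

/-! ### The spectrum of `θ(a, b, c)` -/

section Theta

/-- The vertices that follow the branch vertex `0` on the first path of `θ(a, b, c)`. -/
def thetaTailA (a b c : ℕ) : Fin (a + 1) → ThetaVertex a b c :=
  Fin.snoc (fun i => Sum.inr (Sum.inl i)) (Sum.inl 1)

/-- The vertices that follow the branch vertex `0` on the second path of `θ(a, b, c)`. -/
def thetaTailB (a b c : ℕ) : Fin (b + 1) → ThetaVertex a b c :=
  Fin.snoc (fun i => Sum.inr (Sum.inr (Sum.inl i))) (Sum.inl 1)

/-- The vertices that follow the branch vertex `1` on the third path of `θ(a, b, c)`. -/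
def thetaTailC (a b c : ℕ) : Fin (c + 1) → ThetaVertex a b c :=
  Fin.snoc (fun i => Sum.inr (Sum.inr (Sum.inr i))) (Sum.inl 0)

lemma theta_adj_iff (a b c : ℕ) (p q : ThetaVertex a b c) : (theta a b c).Adj p q ↔
    ((p = Sum.inl 0 ∧ q = thetaTailA a b c 0) ∨
      ∃ i, p = Sum.inr (Sum.inl i) ∧ q = thetaTailA a b c i.succ) ∨
    ((p = Sum.inl 0 ∧ q = thetaTailB a b c 0) ∨
      ∃ i, p = Sum.inr (Sum.inr (Sum.inl i)) ∧ q = thetaTailB a b c i.succ) ∨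
    ((p = Sum.inl 1 ∧ q = thetaTailC a b c 0) ∨
      ∃ i, p = Sum.inr (Sum.inr (Sum.inr i)) ∧ q = thetaTailC a b c i.succ) :=
  or_congr (map_dipath_between _ _ _ p q)
    (or_congr (map_dipath_between _ _ _ p q) (map_dipath_between _ _ _ p q))

variable {a b c : ℕ} (x : ThetaVertex a b c → ℝ)

lemma theta_mulVec_a (i : Fin a) :
    (adjMatrix (theta a b c) *ᵥ x) (Sum.inr (Sum.inl i)) = x (thetaTailA a b c i.succ) :=
  mulVec_of_adj_iff _ _ fun q => by simp [theta_adj_iff]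

lemma theta_mulVec_b (i : Fin b) :
    (adjMatrix (theta a b c) *ᵥ x) (Sum.inr (Sum.inr (Sum.inl i))) =
      x (thetaTailB a b c i.succ) :=
  mulVec_of_adj_iff _ _ fun q => by simp [theta_adj_iff]

lemma theta_mulVec_c (i : Fin c) :
    (adjMatrix (theta a b c) *ᵥ x) (Sum.inr (Sum.inr (Sum.inr i))) =
      x (thetaTailC a b c i.succ) :=
  mulVec_of_adj_iff _ _ fun q => by simp [theta_adj_iff]

lemma theta_mulVec_one :
    (adjMatrix (theta a b c) *ᵥ x) (Sum.inl 1) = x (thetaTailC a b c 0) :=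
  mulVec_of_adj_iff _ _ fun q => by simp [theta_adj_iff]

lemma thetaTailB_zero (hb : 0 < b) :
    thetaTailB a b c 0 = Sum.inr (Sum.inr (Sum.inl ⟨0, hb⟩)) :=
  snoc_zero_of_pos _ _ hb

/-- `0 < b` keeps the two out-neighbours distinct, even when `a = 0`. -/
lemma theta_mulVec_zero (hb : 0 < b) :
    (adjMatrix (theta a b c) *ᵥ x) (Sum.inl 0) =
      x (thetaTailA a b c 0) + x (thetaTailB a b c 0) := by
  refine mulVec_of_adj_iff_or _ _ ?_ fun q => by simp [theta_adj_iff]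
  rw [thetaTailB_zero hb]
  exact snoc_ne (by simp) (by simp) _

theorem spectrum_theta (hb : 0 < b) :
    spectrum (theta a b c) = twoCycleSet (a + c + 2) (b + c + 2) := by
  ext μ
  constructor
  · intro h
    rcases (nonneg_of_mem_spectrum h).eq_or_lt with h0 | hμ
    · exact Or.inl h0.symm
    obtain ⟨x, hx0, hx, h⟩ := (mem_spectrum_iff _ μ).1 h
    have hA := fun i hi => (theta_mulVec_a x i).symm.trans (h _ hi)
    have hB := fun i hi => (theta_mulVec_b x i).symm.trans (h _ hi)
    have hC := fun i hi => (theta_mulVec_c x i).symm.trans (h _ hi)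
    -- The equation at `1` makes the first entry of the third path positive, which excludes the
    -- vanishing case of `path_first`.
    have hvu : 0 < x (Sum.inl 1) → x (Sum.inl 0) = μ ^ (c + 1) * x (Sum.inl 1) := by
      intro hv
      have h1 := (theta_mulVec_one x).symm.trans (h _ hv)
      rcases path_first (v := Sum.inl 0) hμ hx hC with e | e
      · have : 0 < μ * x (Sum.inl 1) := by positivity
        exact absurd (h1.symm.trans e) this.ne'
      · rw [e]
        change μ ^ c * x (thetaTailC a b c 0) = _
        rw [h1]
        ring
    have hu_of_v : 0 < x (Sum.inl 1) → 0 < x (Sum.inl 0) := fun hv => by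
      rw [hvu hv]; positivity
    have hu : 0 < x (Sum.inl 0) := by
      obtain ⟨p, hp⟩ := Function.ne_iff.1 hx0
      have hp : 0 < x p := (hx p).lt_of_ne' hp
      rcases p with p | i | i | i
      · fin_cases p
        · exact hp
        · exact hu_of_v hp
      · exact hu_of_v (path_end_pos hμ hA i hp)
      · exact hu_of_v (path_end_pos hμ hB i hp)
      · exact path_end_pos hμ hC i hp
    have hsum := (theta_mulVec_zero x hb).symm.trans (h _ hu)
    -- Closes a path with `n` inner vertices through the third path to a cycle of length `n + c +
    -- 2`.
    have hfirst : ∀ n : ℕ, ∀ y : ℝ, 0 ≤ y → y = 0 ∨ x (Sum.inl 1) = μ ^ n * y →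
        y = 0 ∨ x (Sum.inl 0) * μ = μ ^ (n + c + 2) * y := by
      intro n y hy0 hy
      rcases hy0.eq_or_lt with e | hpos
      · exact Or.inl e.symm
      · refine hy.imp_right fun e => ?_
        rw [hvu (by rw [e]; positivity), e]
        ring
    exact mem_twoCycleSet_of_return (by omega) (by omega) hμ hu hsum
      (hfirst a _ (hx _) (path_first hμ hx hA)) (hfirst b _ (hx _) (path_first hμ hx hB))
  · intro h
    by_cases h0 : μ = 0
    · subst h0
      refine zero_mem_spectrum _ (p := Sum.inl 0) ?_
      have hA : Sum.inl 0 ≠ thetaTailA a b c 0 := (snoc_ne (by simp) (by simp) _).symm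
      have hB : Sum.inl 0 ≠ thetaTailB a b c 0 := (snoc_ne (by simp) (by simp) _).symm
      simp [theta_adj_iff, hA, hB]
    obtain ⟨hμ, β, hβ, hβ01, hsum⟩ := exists_weight_of_mem_twoCycleSet h h0
    -- Normalised at the branch vertex `1`; the `c + 1` arcs of the third path lead to `μ ^ (c + 1)`
    -- at `0`.
    let x : ThetaVertex a b c → ℝ := Sum.elim ![μ ^ (c + 1), 1] (Sum.elim
      (fun i => (μ ^ a)⁻¹ * μ ^ (i : ℕ)) (Sum.elim (fun i => β * (μ ^ b)⁻¹ * μ ^ (i : ℕ))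
        fun i => μ * μ ^ (i : ℕ)))
    have hu : x (Sum.inl 0) = μ ^ (c + 1) := rfl
    have hv : x (Sum.inl 1) = 1 := rfl
    have hA : ∀ k, x (thetaTailA a b c k) = (μ ^ a)⁻¹ * μ ^ (k : ℕ) :=
      snoc_geometric x _ _ (fun i => rfl)
        (hv.trans (inv_mul_cancel₀ (pow_pos hμ _).ne').symm)
    have hC : ∀ k, x (thetaTailC a b c k) = μ * μ ^ (k : ℕ) :=
      snoc_geometric x _ _ (fun i => rfl) (hu.trans (pow_succ' μ c))
    have hzero : x (thetaTailB a b c 0) = β * (μ ^ b)⁻¹ := by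
      rw [thetaTailB_zero hb]
      simp [x]
    refine (mem_spectrum_iff _ μ).2
      ⟨x, Function.ne_iff.2 ⟨Sum.inl 1, by rw [hv]; exact one_ne_zero⟩, ?_, ?_⟩
    · rintro (p | i | i | i)
      · fin_cases p
        · exact (pow_pos hμ _).le
        · exact zero_le_one
      all_goals simp only [x, Sum.elim_inl, Sum.elim_inr]; positivity
    · rintro (p | i | i | i) hi
      · fin_cases p
        · change (adjMatrix (theta a b c) *ᵥ x) (Sum.inl 0) = μ * x (Sum.inl 0)
          rw [theta_mulVec_zero x hb, hA, hzero, hu, Fin.val_zero, pow_zero, mul_one]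
          have h1 : μ * μ ^ (c + 1) = μ ^ (c + 2) * 1 := by ring
          rw [h1, ← hsum, add_assoc, add_assoc, pow_add μ a, pow_add μ b]
          field_simp
        · change (adjMatrix (theta a b c) *ᵥ x) (Sum.inl 1) = μ * x (Sum.inl 1)
          rw [theta_mulVec_one, hC, hv, Fin.val_zero, pow_zero]
      · rw [theta_mulVec_a, hA]
        simp only [x, Sum.elim_inl, Sum.elim_inr, Fin.val_succ]
        ring
      · rcases hβ01 with rfl | rfl
        · simp [x] at hi
        · have hB : ∀ k, x (thetaTailB a b c k) = 1 * (μ ^ b)⁻¹ * μ ^ (k : ℕ) :=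
            snoc_geometric x _ _ (fun i => rfl)
              (by rw [hv, one_mul, inv_mul_cancel₀ (pow_pos hμ _).ne'])
          rw [theta_mulVec_b, hB]
          simp only [x, Sum.elim_inl, Sum.elim_inr, Fin.val_succ]
          ring
      · rw [theta_mulVec_c, hC]
        simp only [x, Sum.elim_inr, Fin.val_succ]
        ring

lemma add_eq_of_isomorphic_theta {a' b' c' : ℕ}
    (h : Isomorphic (theta a b c) (theta a' b' c')) : a + (b + c) = a' + (b' + c') := by
  obtain ⟨e⟩ := h
  simpa using Fintype.card_congr e.toEquiv

end Theta

end CompSpec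

open CompSpec in
theorem mainTheorem6 :
    (∀ a b c : ℕ, 0 < b → ∃ r s : ℕ, 2 ≤ r ∧ r ≤ s ∧
      CompSpec.spectrum (CompSpec.theta a b c) = CompSpec.spectrum (CompSpec.infty r s)) ∧
    (∀ r s : ℕ, 2 ≤ r → r < s → ∃ a b c : Fin (r - 1) → ℕ,
      (∀ i, a i ≤ b i ∧ 0 < b i ∧
        CompSpec.spectrum (CompSpec.infty r s) =
          CompSpec.spectrum (CompSpec.theta (a i) (b i) (c i))) ∧
      (∀ i j, i ≠ j → ¬ CompSpec.Isomorphic (CompSpec.theta (a i) (b i) (c i))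
        (CompSpec.theta (a j) (b j) (c j)))) ∧
    (∀ r : ℕ, 2 ≤ r → ∃ a b c : Fin (r - 2) → ℕ,
      (∀ i, a i ≤ b i ∧ 0 < b i ∧
        CompSpec.spectrum (CompSpec.infty r r) =
          CompSpec.spectrum (CompSpec.theta (a i) (b i) (c i))) ∧
      (∀ i j, i ≠ j → ¬ CompSpec.Isomorphic (CompSpec.theta (a i) (b i) (c i))
        (CompSpec.theta (a j) (b j) (c j)))) := by
  refine ⟨fun a b c hb => ?_, fun r s hr hrs => ?_, fun r hr => ?_⟩
  · rcases le_total a b with hab | hab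
    · refine ⟨a + c + 2, b + c + 2, by omega, by omega, ?_⟩
      rw [spectrum_theta hb, spectrum_infty (by omega) (by omega)]
    · refine ⟨b + c + 2, a + c + 2, by omega, by omega, ?_⟩
      rw [spectrum_theta hb, spectrum_infty (by omega) (by omega), twoCycleSet_comm]
  -- All subtractions are exact as `i ≤ r - 2`, and `r < s` keeps `b` positive up to `i = r - 2`.
  · refine ⟨fun i => r - 2 - i, fun i => s - 2 - i, fun i => i, fun i => ?_, fun i j hij h => ?_⟩
    · have hi := i.isLt
      dsimp only
      refine ⟨by omega, by omega, ?_⟩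
      rw [spectrum_theta (by omega), spectrum_infty hr (by omega)]
      congr 1 <;> omega
    · have hi := i.isLt
      have hj := j.isLt
      have := add_eq_of_isomorphic_theta h
      dsimp only at this
      exact hij (Fin.ext (by omega))
  -- Now `i = r - 2` would give `a = b = 0`, hence one digraph fewer.
  · refine ⟨fun i => r - 2 - i, fun i => r - 2 - i, fun i => i, fun i => ?_, fun i j hij h => ?_⟩
    · have hi := i.isLt
      dsimp only
      refine ⟨le_rfl, by omega, ?_⟩
      rw [spectrum_theta (by omega), spectrum_infty hr hr]
      congr 1 <;> omega
    · have hi := i.isLt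
      have hj := j.isLt
      have := add_eq_of_isomorphic_theta h
      dsimp only at this
      exact hij (Fin.ext (by omega))
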